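/- Let $k\ge 2$ be an integer. A power series $F\in\mathbb{C}[[z]]$ is called $k$-Mahler if there are an integer $m\ge 1$ and polynomials $a_0,\dots,a_m\in\mathbb{C}[z]$, not all zero, with $$a_0(z)F(z)+a_1(z)F(z^k)+\cdots+a_m(z)F(z^{k^m})=0;$$ the characteristic polynomial of this equation is $p(\lambda)=a_0(1)\lambda^m+a_1(1)\lambda^{m-1}+\cdots+a_m(1)$. If $F$ converges in the open unit disc, we say that a nonzero complex number $\lambda_F$ is the Mahler eigenvalue of $F$ if it is a root of the nonzero characteristic polynomial of some such equation for $F$ and, as $z\to1^-$ along the reals, $$F(z)=\frac{C_F(z)}{(1-z)^{\log_k\lambda_F}}(1+o(1)),$$ where $\log_k$ is the principal value of the base-$k$ logarithm and $C_F:(0,1)\to\mathbb{C}$ is real-analytic, bounded away from $0$ and $\infty$, and satisfies $C_F(z)=C_F(z^k)$ on $(0,1)$. Theorem. Let $F_1,\dots,F_d\in\mathbb{C}[[z]]$ be $k$-Mahler power series that converge in the open unit disc and whose Mahler eigenvalues $\lambda_{F_1},\dots,\lambda_{F_d}$ exist. Let $\mathcal{M}$ be the set of meromorphic functions on $\mathbb{C}$,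 regarded as elements of $\mathbb{C}((z))$ through their Laurent expansions at $0$. If $k,\lambda_{F_1},\dots,\lambda_{F_d}$ are multiplicatively independent, that is, if $k^{n_0}\lambda_{F_1}^{n_1}\cdots\lambda_{F_d}^{n_d}=1$ with integers $n_0,\dots,n_d$ forces $n_0=\cdots=n_d=0$, then $$\operatorname{trdeg}_{\mathbb{C}(z)(\mathcal{M})}\mathbb{C}(z)(\mathcal{M})(F_1,\dots,F_d)=d,$$ i.e. $F_1,\dots,F_d$ are algebraically independent over $\mathbb{C}(z)(\mathcal{M})$. In particular, they are algebraically independent over $\mathbb{C}(z)$. -/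

import Mathlib

open scoped Topology LaurentSeries RatFunc
open Filter

noncomputable section

/-- `a 0 (z) F(z) + a 1 (z) F(z^k) + ... + a m (z) F(z^(k^m)) = 0` in `ℂ⟦z⟧`, where `m ≥ 1` and the
polynomials `a 0, ..., a m` are not all zero. -/
def IsMahlerEquation (k m : ℕ) (a : Fin (m + 1) → Polynomial ℂ) (F : PowerSeries ℂ) : Prop :=
  1 ≤ m ∧ a ≠ 0 ∧
    ∑ i : Fin (m + 1), (a i : PowerSeries ℂ) *
      F.subst (PowerSeries.X ^ (k ^ (i : ℕ)) : PowerSeries ℂ) = 0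

/-- `F` is a `k`-Mahler power series. -/
def IsMahler (k : ℕ) (F : PowerSeries ℂ) : Prop :=
  ∃ (m : ℕ) (a : Fin (m + 1) → Polynomial ℂ), IsMahlerEquation k m a F

/-- The characteristic polynomial `a 0 (1) λ^m + a 1 (1) λ^(m-1) + ... + a m (1)` of the equation
with coefficients `a`. -/
def mahlerCharpoly (m : ℕ) (a : Fin (m + 1) → Polynomial ℂ) : Polynomial ℂ :=
  ∑ i : Fin (m + 1), Polynomial.C ((a i).eval 1) * Polynomial.X ^ (m - (i : ℕ))

/-- `F` converges in the open unit disc. -/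
def ConvergesInUnitDisc (F : PowerSeries ℂ) : Prop :=
  ∀ z : ℂ, ‖z‖ < 1 → Summable fun n : ℕ => PowerSeries.coeff n F * z ^ n

/-- The sum of the power series `F` at `z` (meaningful where the series converges). -/
def evalSeries (F : PowerSeries ℂ) (z : ℂ) : ℂ :=
  ∑' n : ℕ, PowerSeries.coeff n F * z ^ n

/-- `lam` is the Mahler eigenvalue of `F`: a nonzero root of the (nonzero) characteristic polynomial
of a Mahler equation of `F` such that, as `z → 1⁻` along the reals,
`F(z) = C(z) / (1 - z)^(log_k lam) * (1 + o(1))`, where `log_k` is the principal value and `C` is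
real-analytic on `(0,1)`, bounded away from `0` and `∞` there, and `C(z) = C(z^k)`. -/
def IsMahlerEigenvalue (k : ℕ) (F : PowerSeries ℂ) (lam : ℂ) : Prop :=
  lam ≠ 0 ∧
  (∃ (m : ℕ) (a : Fin (m + 1) → Polynomial ℂ), IsMahlerEquation k m a F ∧
    mahlerCharpoly m a ≠ 0 ∧ (mahlerCharpoly m a).IsRoot lam) ∧
  ∃ C : ℝ → ℂ,
    AnalyticOnNhd ℝ C (Set.Ioo 0 1) ∧
    (∃ b B : ℝ, 0 < b ∧ ∀ x ∈ Set.Ioo (0 : ℝ) 1, b ≤ ‖C x‖ ∧ ‖C x‖ ≤ B) ∧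
    (∀ x ∈ Set.Ioo (0 : ℝ) 1, C x = C (x ^ k)) ∧
    Asymptotics.IsEquivalent (𝓝[<] (1 : ℝ)) (fun x : ℝ => evalSeries F (x : ℂ))
      (fun x : ℝ => C x / ((1 - x : ℝ) : ℂ) ^ (Complex.log lam / (Real.log (k : ℝ) : ℂ)))

/-- Multiplicative independence of a finite family of complex numbers: all are nonzero, and only the
trivial monomial with integer exponents in them is equal to `1`. -/
def MultiplicativelyIndependent {ι : Type*} [Fintype ι] (x : ι → ℂ) : Prop :=
  (∀ i, x i ≠ 0) ∧ ∀ n : ι → ℤ, ∏ i, x i ^ n i = 1 → n = 0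

/-- The meromorphic functions on `ℂ`, each represented by its Laurent expansion at `0`, inside the
field `ℂ((z))`. -/
def meromorphicSeries : Set ℂ⸨X⸩ :=
  {f | ∃ g : ℂ → ℂ, Meromorphic g ∧
    ∀ᶠ z in 𝓝[≠] (0 : ℂ), HasSum (fun n : ℤ => f.coeff n * z ^ n) (g z)}

/-- The field `ℂ(z)(M)`, where `M` is the set of meromorphic functions on `ℂ`, inside `ℂ((z))`. -/
def meromorphicField : IntermediateField (RatFunc ℂ) ℂ⸨X⸩ :=
  IntermediateField.adjoin (RatFunc ℂ) meromorphicSeries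

end

/-!
The proof compares growth rates along a single sequence of points. Put `x_j = exp (-k⁻ʲ)`, so that
`x_{j+1} ^ k = x_j` and `x_j → 1⁻`. The oscillating factor `C_F` takes the same nonzero value at all
the `x_j`, and `1 - x_j` is asymptotic to `k⁻ʲ`, so `F(x_j)` is asymptotic to a nonzero multiple of
`λ_F ^ j` (`IsMahlerEigenvalue.tendsto_evalSeries`). A meromorphic function of finite order `m` at
`1` is, at `x_j`, asymptotic to a nonzero multiple of `(k ^ (-m)) ^ j`
(`tendsto_meromorphic_radialPoint`).

Consider an algebraic relation `∑ g_μ F ^ μ = 0` in `ℂ((z))`. Its coefficients are expansions of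
meromorphic functions, because these already form a field containing `ℂ(z)`
(`exists_meromorphic_of_mem_meromorphicField`), so the relation holds between functions near `0`.
By the identity principle in the unit disc it holds at `x_j` for all large `j`
(`eventually_radialPoint_eq_zero`). There the term of index `μ` is asymptotic to a nonzero multiple
of the `j`-th power of `k ^ n_μ * λ ^ μ`, and by multiplicative independence these ratios are
distinct for distinct `μ`. Ratios may share the same modulus, but a combination of powers of
distinct numbers of modulus `1` does not tend to zero unless it is trivial
(`eq_zero_of_tendsto_sum_mul_pow`). Hence the terms of dominant modulus cannot cancel
(`eq_empty_of_eventually_sum_eq_zero`), and no nontrivial relation exists.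
-/

/-! ### Laurent expansions at the origin -/

/-- The product of two convergent Laurent series is evaluated by regrouping the double sum along the
diagonals `i + j = n`. -/
theorem hasSum_coeff_mul_zpow {f₁ f₂ : ℂ⸨X⸩} {z a b : ℂ} (hz : z ≠ 0)
    (h1 : HasSum (fun n : ℤ => f₁.coeff n * z ^ n) a)
    (h2 : HasSum (fun n : ℤ => f₂.coeff n * z ^ n) b) :
    HasSum (fun n : ℤ => (f₁ * f₂).coeff n * z ^ n) (a * b) := by
  have hs := summable_mul_of_summable_norm h1.summable.norm h2.summable.norm
  have hprod := h1.mul h2 hs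
  obtain ⟨e, he⟩ : ∃ e : ℤ × ℤ ≃ ℤ × ℤ, ∀ p, e p = (p.2, p.1 - p.2) :=
    ⟨{ toFun := fun p => (p.2, p.1 - p.2)
       invFun := fun p => (p.1 + p.2, p.1)
       left_inv := fun p => by simp
       right_inv := fun p => by simp }, fun _ => rfl⟩
  rw [← e.hasSum_iff] at hprod
  refine hprod.prod_fiberwise fun n => ?_
  have hterm : ∀ i, (f₁.coeff i * z ^ i) * (f₂.coeff (n - i) * z ^ (n - i)) =
      f₁.coeff i * f₂.coeff (n - i) * z ^ n := fun i => by
    rw [mul_mul_mul_comm, ← zpow_add₀ hz, add_sub_cancel]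
  have hcoeff : (f₁ * f₂).coeff n =
      ∑ i ∈ (Finset.antidiagonal f₁.isPWO_support f₂.isPWO_support n).image Prod.fst,
        f₁.coeff i * f₂.coeff (n - i) := by
    rw [HahnSeries.coeff_mul, Finset.sum_image]
    · refine Finset.sum_congr rfl fun ij hij => ?_
      rw [← (Finset.mem_antidiagonal.1 hij).2.2, add_sub_cancel_left]
    · intro a ha b hb hab
      have h3 := (Finset.mem_antidiagonal.1 (Finset.mem_coe.1 ha)).2.2
      have h4 := (Finset.mem_antidiagonal.1 (Finset.mem_coe.1 hb)).2.2
      have hab' : a.1 = b.1 := hab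
      exact Prod.ext hab' (by lia)
  simp only [Function.comp_apply, he, hterm, hcoeff]
  refine HasSum.mul_right _ (hasSum_sum_of_ne_finset_zero fun i hi => ?_)
  contrapose! hi
  refine Finset.mem_image.2 ⟨(i, n - i), Finset.mem_antidiagonal.2 ⟨?_, ?_, by simp⟩, rfl⟩
  · exact left_ne_zero_of_mul hi
  · exact right_ne_zero_of_mul hi

/-- The Laurent series `f` converges to the function `g` on a punctured neighbourhood of `0`. -/
def IsLaurentExpansion (f : ℂ⸨X⸩) (g : ℂ → ℂ) : Prop :=
  ∀ᶠ z in 𝓝[≠] (0 : ℂ), HasSum (fun n : ℤ => f.coeff n * z ^ n) (g z)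

namespace IsLaurentExpansion

theorem congr {f : ℂ⸨X⸩} {g g' : ℂ → ℂ} (h : IsLaurentExpansion f g)
    (hg : g =ᶠ[𝓝[≠] 0] g') : IsLaurentExpansion f g' := by
  filter_upwards [h, hg] with z h1 h2
  exact h2 ▸ h1

theorem single (m : ℤ) (c : ℂ) :
    IsLaurentExpansion (HahnSeries.single m c) (fun z => c * z ^ m) := by
  refine Eventually.of_forall fun z => ?_
  have := hasSum_single (f := fun n : ℤ => (HahnSeries.single m c : ℂ⸨X⸩).coeff n * z ^ n) m
    (fun n hn => by simp [HahnSeries.coeff_single_of_ne hn])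
  simpa using this

theorem zero : IsLaurentExpansion 0 0 :=
  Eventually.of_forall fun z => by simp

theorem one : IsLaurentExpansion 1 1 :=
  (single 0 1).congr (Eventually.of_forall fun z => by simp)

theorem add {f₁ f₂ : ℂ⸨X⸩} {g₁ g₂ : ℂ → ℂ} (h₁ : IsLaurentExpansion f₁ g₁)
    (h₂ : IsLaurentExpansion f₂ g₂) : IsLaurentExpansion (f₁ + f₂) (g₁ + g₂) := by
  filter_upwards [h₁, h₂] with z h1 h2
  simpa [add_mul] using h1.add h2

theorem mul {f₁ f₂ : ℂ⸨X⸩} {g₁ g₂ : ℂ → ℂ} (h₁ : IsLaurentExpansion f₁ g₁)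
    (h₂ : IsLaurentExpansion f₂ g₂) : IsLaurentExpansion (f₁ * f₂) (g₁ * g₂) := by
  filter_upwards [h₁, h₂, self_mem_nhdsWithin] with z h1 h2 hz
  exact hasSum_coeff_mul_zpow hz h1 h2

theorem finset_sum {ι : Type*} (s : Finset ι) {f : ι → ℂ⸨X⸩} {g : ι → ℂ → ℂ}
    (h : ∀ i ∈ s, IsLaurentExpansion (f i) (g i)) :
    IsLaurentExpansion (∑ i ∈ s, f i) (∑ i ∈ s, g i) := by
  classical
  induction s using Finset.induction_on with
  | empty => simpa using zero
  | insert a s ha ih =>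
    rw [Finset.sum_insert ha, Finset.sum_insert ha]
    exact (h a (Finset.mem_insert_self a s)).add
      (ih fun i hi => h i (Finset.mem_insert_of_mem hi))

theorem pow {f : ℂ⸨X⸩} {g : ℂ → ℂ} (h : IsLaurentExpansion f g) (n : ℕ) :
    IsLaurentExpansion (f ^ n) (g ^ n) := by
  induction n with
  | zero => simpa using one
  | succ n ih => simpa [pow_succ] using ih.mul h

theorem finset_prod {ι : Type*} (s : Finset ι) {f : ι → ℂ⸨X⸩} {g : ι → ℂ → ℂ}
    (h : ∀ i ∈ s, IsLaurentExpansion (f i) (g i)) :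
    IsLaurentExpansion (∏ i ∈ s, f i) (∏ i ∈ s, g i) := by
  classical
  induction s using Finset.induction_on with
  | empty => simpa using one
  | insert a s ha ih =>
    rw [Finset.prod_insert ha, Finset.prod_insert ha]
    exact (h a (Finset.mem_insert_self a s)).mul
      (ih fun i hi => h i (Finset.mem_insert_of_mem hi))

theorem coe_powerSeries {p : PowerSeries ℂ} {g : ℂ → ℂ}
    (h : ∀ᶠ z in 𝓝[≠] (0 : ℂ), HasSum (fun n : ℕ => PowerSeries.coeff n p * z ^ n) (g z)) :
    IsLaurentExpansion (p : ℂ⸨X⸩) g := by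
  filter_upwards [h] with z hz
  rw [← Nat.cast_injective (R := ℤ).hasSum_iff]
  · simpa [Function.comp_def, LaurentSeries.coeff_coe_powerSeries] using hz
  · intro n hn
    have : n < 0 := by
      by_contra hneg
      exact hn ⟨n.toNat, by simp [not_lt.1 hneg]⟩
    simp [PowerSeries.coeff_coe, this]

end IsLaurentExpansion

/-- A power series that converges on an open disc is analytic there. -/
theorem analyticOnNhd_evalSeries {p : PowerSeries ℂ} {r : ℝ}
    (h : ∀ z : ℂ, ‖z‖ < r → Summable fun n : ℕ => PowerSeries.coeff n p * z ^ n) :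
    AnalyticOnNhd ℂ (evalSeries p) (Metric.ball 0 r) := by
  intro w hw
  have hwr : ‖w‖ < r := by simpa using hw
  set q := FormalMultilinearSeries.ofScalars ℂ (fun n => PowerSeries.coeff n p) with hq
  have hrad : ENNReal.ofReal r ≤ q.radius := by
    refine ENNReal.le_of_forall_nnreal_lt fun t ht => ?_
    apply q.le_radius_of_summable
    have htr : (t : ℝ) < r := by
      have : ENNReal.ofReal t < ENNReal.ofReal r := by simpa using ht
      exact (ENNReal.ofReal_lt_ofReal_iff_of_nonneg t.2).1 this
    have := (h ((t : ℝ) : ℂ) (by simpa using htr)).norm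
    simpa [hq, FormalMultilinearSeries.ofScalars_norm] using this
  have hr0 : 0 < r := (norm_nonneg w).trans_lt hwr
  have hpos : 0 < q.radius := (ENNReal.ofReal_pos.2 hr0).trans_le hrad
  have hsum : q.sum = evalSeries p := by
    ext z
    simp [FormalMultilinearSeries.sum, evalSeries, hq,
      mul_comm]
  rw [← hsum]
  refine (q.hasFPowerSeriesOnBall hpos).analyticAt_of_mem ?_
  refine Metric.eball_subset_eball hrad ?_
  simpa [Metric.eball_ofReal] using hwr

theorem IsLaurentExpansion.eq_zero {f : ℂ⸨X⸩} (h : IsLaurentExpansion f 0) : f = 0 := by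
  by_contra hf
  -- after division by `z ^ order`, continuity at `0` makes the leading coefficient vanish
  obtain ⟨r, hr, hball⟩ := Metric.mem_nhdsWithin_iff.1 h
  have key : ∀ z : ℂ, z ≠ 0 → ‖z‖ < r →
      HasSum (fun n : ℕ => PowerSeries.coeff n f.powerSeriesPart * z ^ n) 0 := by
    intro z hz hzr
    have h1 : HasSum (fun n : ℤ => f.coeff n * z ^ n) 0 := hball ⟨by simpa using hzr, hz⟩
    have hinj : Function.Injective fun n : ℕ => f.order + (n : ℤ) := fun a b hab => by
      simpa using hab
    rw [← hinj.hasSum_iff] at h1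
    · have h2 := h1.mul_right (z ^ (-f.order))
      rw [zero_mul] at h2
      refine h2.congr_fun fun n => ?_
      rw [Function.comp_apply, LaurentSeries.powerSeriesPart_coeff, zpow_add₀ hz, zpow_neg,
        zpow_natCast]
      field_simp
    · intro n hn
      have : n < f.order := by
        by_contra hneg
        exact hn ⟨(n - f.order).toNat, by simp [not_lt.1 hneg]⟩
      simp [HahnSeries.coeff_eq_zero_of_lt_order this]
  have hsm : ∀ z : ℂ, ‖z‖ < r →
      Summable fun n : ℕ => PowerSeries.coeff n f.powerSeriesPart * z ^ n := by
    intro z hz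
    by_cases hz0 : z = 0
    · subst hz0
      exact summable_of_ne_finset_zero (s := {0}) fun n hn => by
        simp [(by simpa using hn : n ≠ 0)]
    · exact (key z hz0 hz).summable
  have hc : ContinuousAt (evalSeries f.powerSeriesPart) 0 :=
    (analyticOnNhd_evalSeries hsm 0 (by simpa using hr)).continuousAt
  have h0 : evalSeries f.powerSeriesPart 0 = 0 := by
    refine tendsto_nhds_unique (l := 𝓝[≠] (0 : ℂ))
      (hc.tendsto.mono_left nhdsWithin_le_nhds) ?_
    refine tendsto_const_nhds.congr' ?_
    filter_upwards [self_mem_nhdsWithin,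
      mem_nhdsWithin_of_mem_nhds (Metric.ball_mem_nhds (0 : ℂ) hr)] with z hz hzr
    exact ((key z hz (by simpa using hzr)).tsum_eq).symm
  have h1 : evalSeries f.powerSeriesPart 0 = f.coeff f.order := by
    rw [evalSeries, tsum_eq_single 0 (fun n hn => by simp [hn])]
    simp
  exact HahnSeries.coeff_order_eq_zero.not.2 hf (h1 ▸ h0)

theorem IsLaurentExpansion.unique {f₁ f₂ : ℂ⸨X⸩} {g : ℂ → ℂ} (h₁ : IsLaurentExpansion f₁ g)
    (h₂ : IsLaurentExpansion f₂ g) : f₁ = f₂ := by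
  have h3 : IsLaurentExpansion (-1 : ℂ⸨X⸩) (-1) := by
    simpa using! (IsLaurentExpansion.single 0 (-1)).congr (g' := -1)
      (Eventually.of_forall fun z => by simp)
  have h4 : IsLaurentExpansion (f₁ + (-1) * f₂) 0 :=
    (h₁.add (h3.mul h₂)).congr (Eventually.of_forall fun z => by simp)
  have := h4.eq_zero
  linear_combination this

theorem MeromorphicAt.exists_isLaurentExpansion {g : ℂ → ℂ} (hg : MeromorphicAt g 0) :
    ∃ f, IsLaurentExpansion f g := by
  obtain ⟨n, q, hq⟩ := hg
  rw [hasFPowerSeriesAt_iff] at hq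
  have hp : IsLaurentExpansion (PowerSeries.mk q.coeff : PowerSeries ℂ) fun z => z ^ n * g z := by
    refine .coe_powerSeries (Filter.Eventually.filter_mono nhdsWithin_le_nhds ?_)
    filter_upwards [hq] with z hz
    simpa [mul_comm] using hz
  refine ⟨_, ((IsLaurentExpansion.single (-n) 1).mul hp).congr ?_⟩
  filter_upwards [self_mem_nhdsWithin] with z hz
  have hz0 : z ≠ 0 := hz
  simp [hz0]

/-! ### The field of meromorphic functions -/

/-- The field of Laurent expansions at `0` of the meromorphic functions on `ℂ`. -/
def meromorphicSubfield : Subfield ℂ⸨X⸩ where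
  carrier := meromorphicSeries
  zero_mem' := ⟨0, .const 0, IsLaurentExpansion.zero⟩
  one_mem' := ⟨1, .const 1, IsLaurentExpansion.one⟩
  add_mem' := by
    rintro _ _ ⟨g₁, m₁, h₁⟩ ⟨g₂, m₂, h₂⟩
    exact ⟨g₁ + g₂, m₁.add m₂, IsLaurentExpansion.add h₁ h₂⟩
  mul_mem' := by
    rintro _ _ ⟨g₁, m₁, h₁⟩ ⟨g₂, m₂, h₂⟩
    exact ⟨g₁ * g₂, m₁.mul m₂, IsLaurentExpansion.mul h₁ h₂⟩
  neg_mem' := by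
    rintro _ ⟨g, m, h⟩
    refine ⟨-g, m.neg, ?_⟩
    filter_upwards [h] with z hz
    simpa using hz.neg
  inv_mem' := by
    rintro f ⟨g, m, h⟩
    by_cases hf : f = 0
    · exact hf ▸ ⟨0, .const 0, by simp⟩
    obtain ⟨f', hf'⟩ := (m.inv 0).exists_isLaurentExpansion
    have hne : ∀ᶠ z in 𝓝[≠] (0 : ℂ), g z ≠ 0 := by
      refine (m 0).eventually_eq_zero_or_eventually_ne_zero.resolve_left fun h0 => hf ?_
      exact (IsLaurentExpansion.congr h h0).eq_zero
    have h1 : IsLaurentExpansion (f * f') 1 := by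
      refine (IsLaurentExpansion.mul h hf').congr ?_
      filter_upwards [hne] with z hz
      simp [hz]
    have : f⁻¹ = f' := inv_eq_of_mul_eq_one_right (h1.unique .one)
    exact this ▸ ⟨g⁻¹, m.inv, hf'⟩

theorem coe_ratFunc_mem_meromorphicSubfield (x : RatFunc ℂ) :
    algebraMap (RatFunc ℂ) ℂ⸨X⸩ x ∈ meromorphicSubfield := by
  have hpoly : ∀ p : Polynomial ℂ,
      ((p : PowerSeries ℂ) : ℂ⸨X⸩) ∈ meromorphicSubfield := by
    intro p
    refine ⟨fun z => p.eval z, fun z => ?_, ?_⟩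
    · exact (AnalyticOnNhd.eval_polynomial (A := ℂ) p z (Set.mem_univ z)).meromorphicAt
    · refine IsLaurentExpansion.coe_powerSeries (Eventually.of_forall fun z => ?_)
      rw [Polynomial.eval_eq_sum_range]
      simp only [Polynomial.coeff_coe]
      exact hasSum_sum_of_ne_finset_zero fun n hn => by
        simp [Polynomial.coeff_eq_zero_of_natDegree_lt (by simpa using hn)]
  rw [← RatFunc.num_div_denom x, map_div₀]
  refine div_mem ?_ ?_
  · have := hpoly x.num
    rwa [RatFunc.coe_coe] at this
  · have := hpoly x.denom
    rwa [RatFunc.coe_coe] at this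

/-- `ℂ(z)(M) = M`: adjoining the meromorphic functions to `ℂ(z)` yields nothing else. -/
theorem exists_meromorphic_of_mem_meromorphicField {f : ℂ⸨X⸩} (hf : f ∈ meromorphicField) :
    ∃ g : ℂ → ℂ, Meromorphic g ∧ IsLaurentExpansion f g := by
  have hle : meromorphicField ≤
      meromorphicSubfield.toIntermediateField coe_ratFunc_mem_meromorphicSubfield :=
    IntermediateField.adjoin_le_iff.2 fun _ hx => hx
  exact hle hf

/-! ### Exponential sums tending to zero -/

theorem eq_zero_of_tendsto_sum_mul_pow {ι : Type*} (T : Finset ι) (w : ι → ℂ)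
    (hw : ∀ i ∈ T, ‖w i‖ = 1) (hinj : Set.InjOn w T) (a : ι → ℂ)
    (h : Tendsto (fun j : ℕ => ∑ i ∈ T, a i * w i ^ j) atTop (𝓝 0)) :
    ∀ i ∈ T, a i = 0 := by
  classical
  induction T using Finset.induction_on generalizing a with
  | empty => simp
  | insert b T hb ih =>
    -- subtracting `w b` times the sequence from its shift eliminates the index `b`
    have hzero : ∀ i ∈ T, a i = 0 := by
      have h1 : Tendsto (fun j : ℕ => ∑ i ∈ T, (a i * (w i - w b)) * w i ^ j) atTop (𝓝 0) := by
        have h2 := ((tendsto_add_atTop_iff_nat 1).2 h).sub (h.const_mul (w b))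
        rw [mul_zero, sub_zero] at h2
        refine h2.congr fun j => ?_
        rw [Finset.sum_insert hb, Finset.sum_insert hb, mul_add, Finset.mul_sum,
          add_sub_add_comm, ← Finset.sum_sub_distrib, pow_succ]
        rw [show a b * (w b ^ j * w b) - w b * (a b * w b ^ j) = 0 by ring, zero_add]
        exact Finset.sum_congr rfl fun i _ => by ring
      intro i hi
      have h3 := ih (fun i hi => hw i (Finset.mem_insert_of_mem hi))
        (hinj.mono (by simp)) _ h1 i hi
      refine (mul_eq_zero.1 h3).resolve_right fun h4 => hb ?_
      rwa [← hinj (Finset.mem_insert_of_mem hi) (Finset.mem_insert_self b T) (sub_eq_zero.1 h4)]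
    have hbz : a b = 0 := by
      have h1 : Tendsto (fun _ : ℕ => ‖a b‖) atTop (𝓝 0) := by
        refine (tendsto_zero_iff_norm_tendsto_zero.1 h).congr fun j => ?_
        rw [Finset.sum_insert hb, Finset.sum_eq_zero fun i hi => by rw [hzero i hi, zero_mul],
          add_zero, norm_mul, norm_pow, hw b (Finset.mem_insert_self b T), one_pow, mul_one]
      exact norm_eq_zero.1 (tendsto_nhds_unique tendsto_const_nhds h1)
    intro i hi
    rcases Finset.mem_insert.1 hi with rfl | hi
    exacts [hbz, hzero i hi]

/-- Sequences asymptotic to nonzero multiples of geometric sequences with distinct ratios have a sum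
that does not vanish eventually. The ratios of largest modulus dominate. -/
theorem eq_empty_of_eventually_sum_eq_zero {ι : Type*} (S : Finset ι) (ρ : ι → ℂ)
    (hρ : ∀ i ∈ S, ρ i ≠ 0) (hinj : Set.InjOn ρ S) (u : ι → ℕ → ℂ) (a : ι → ℂ)
    (ha : ∀ i ∈ S, a i ≠ 0)
    (hu : ∀ i ∈ S, Tendsto (fun j => u i j / ρ i ^ j) atTop (𝓝 (a i)))
    (hsum : ∀ᶠ j in atTop, ∑ i ∈ S, u i j = 0) : S = ∅ := by
  classical
  by_contra hS
  obtain ⟨m, hm, hmax⟩ := S.exists_max_image (fun i => ‖ρ i‖) (Finset.nonempty_iff_ne_empty.2 hS)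
  set R : ℂ := (‖ρ m‖ : ℂ) with hR
  have hR0 : R ≠ 0 := by simpa [hR] using hρ m hm
  set b : ι → ℂ := fun i => if ‖ρ i‖ = ‖ρ m‖ then a i else 0 with hb
  -- after division by `R ^ j`, only the dominant terms survive
  have hterm : ∀ i ∈ S, Tendsto (fun j => u i j / R ^ j - b i * (ρ i / R) ^ j) atTop (𝓝 0) := by
    intro i hi
    have hbnd : Tendsto (fun j => (u i j / ρ i ^ j - b i) * (ρ i / R) ^ j) atTop (𝓝 0) := by
      by_cases hi' : ‖ρ i‖ = ‖ρ m‖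
      · have hw : ‖ρ i / R‖ = 1 := by
          rw [norm_div, hR, Complex.norm_real, norm_norm, hi', div_self]
          simpa using hρ m hm
        have h1 : Tendsto (fun j => u i j / ρ i ^ j - b i) atTop (𝓝 0) := by
          have := (hu i hi).sub_const (a i)
          simpa [hb, hi'] using this
        rw [tendsto_zero_iff_norm_tendsto_zero] at h1 ⊢
        simpa only [norm_mul, norm_pow, hw, one_pow, mul_one] using! h1
      · have hw : ‖ρ i / R‖ < 1 := by
          rw [norm_div, hR, Complex.norm_real, norm_norm,
            div_lt_one (norm_pos_iff.2 (hρ m hm))]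
          exact lt_of_le_of_ne (hmax i hi) hi'
        simpa using ((hu i hi).sub_const (b i)).mul (tendsto_pow_atTop_nhds_zero_of_norm_lt_one hw)
    refine hbnd.congr fun j => ?_
    have := pow_ne_zero j (hρ i hi)
    rw [div_pow]
    field_simp
  have hlim : Tendsto (fun j : ℕ => ∑ i ∈ S with ‖ρ i‖ = ‖ρ m‖, b i * (ρ i / R) ^ j)
      atTop (𝓝 0) := by
    have h1 := (tendsto_finsetSum S hterm).neg
    rw [Finset.sum_const_zero, neg_zero] at h1
    refine h1.congr' ?_
    filter_upwards [hsum] with j hj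
    rw [Finset.sum_sub_distrib, ← Finset.sum_div, hj, zero_div, zero_sub, neg_neg,
      Finset.sum_filter]
    refine Finset.sum_congr rfl fun i _ => ?_
    by_cases h : ‖ρ i‖ = ‖ρ m‖ <;> simp [hb, h]
  have hbm := eq_zero_of_tendsto_sum_mul_pow _ (fun i => ρ i / R) ?_ ?_ b hlim m
    (Finset.mem_filter.2 ⟨hm, rfl⟩)
  · exact ha m hm (by simpa [hb] using hbm)
  · intro i hi
    rw [norm_div, hR, Complex.norm_real, norm_norm, (Finset.mem_filter.1 hi).2, div_self]
    simpa using hρ m hm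
  · intro i hi j hj hij
    exact hinj (Finset.mem_filter.1 hi).1 (Finset.mem_filter.1 hj).1
      ((div_left_inj' hR0).1 hij)

/-! ### Asymptotics along the points `exp (-k⁻ʲ)` -/

noncomputable section

/-- The orbit of `e⁻¹` under taking `k`-th roots: these points of `(0, 1)` increase to `1`. -/
def radialPoint (k j : ℕ) : ℝ := Real.exp (-((k : ℝ) ^ j)⁻¹)

theorem radialPoint_mem_Ioo {k : ℕ} (hk : 2 ≤ k) (j : ℕ) :
    radialPoint k j ∈ Set.Ioo (0 : ℝ) 1 := by
  have : (0 : ℝ) < k := by positivity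
  exact ⟨Real.exp_pos _, Real.exp_zero ▸ Real.exp_lt_exp.2 (neg_lt_zero.2 (by positivity))⟩

theorem radialPoint_succ_pow {k : ℕ} (hk : 2 ≤ k) (j : ℕ) :
    radialPoint k (j + 1) ^ k = radialPoint k j := by
  have : (k : ℝ) ≠ 0 := by positivity
  rw [radialPoint, radialPoint, ← Real.exp_nat_mul, pow_succ]
  congr 1
  field_simp

theorem tendsto_inv_pow_nhdsNE {k : ℕ} (hk : 2 ≤ k) :
    Tendsto (fun j : ℕ => -((k : ℝ) ^ j)⁻¹) atTop (𝓝[≠] 0) := by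
  have h1 : (1 : ℝ) < k := by exact_mod_cast hk
  refine tendsto_nhdsWithin_iff.2 ⟨?_, Eventually.of_forall fun j => ?_⟩
  · simpa using (tendsto_inv_atTop_zero.comp (tendsto_pow_atTop_atTop_of_one_lt h1)).neg
  · have : (0 : ℝ) < k := by positivity
    exact (neg_lt_zero.2 (by positivity)).ne

theorem tendsto_radialPoint {k : ℕ} (hk : 2 ≤ k) :
    Tendsto (radialPoint k) atTop (𝓝[<] 1) := by
  refine tendsto_nhdsWithin_iff.2
    ⟨?_, Eventually.of_forall fun j => (radialPoint_mem_Ioo hk j).2⟩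
  have h := (tendsto_inv_pow_nhdsNE hk).mono_right nhdsWithin_le_nhds
  simpa using! (Real.continuous_exp.tendsto 0).comp h

/-- `1 - radialPoint k j` is asymptotic to `k⁻ʲ`. -/
theorem tendsto_one_sub_radialPoint_mul {k : ℕ} (hk : 2 ≤ k) :
    Tendsto (fun j => (1 - radialPoint k j) * (k : ℝ) ^ j) atTop (𝓝 1) := by
  have h := (hasDerivAt_iff_tendsto_slope.1 (Real.hasDerivAt_exp 0)).comp
    (tendsto_inv_pow_nhdsNE hk)
  rw [Real.exp_zero] at h
  refine h.congr fun j => ?_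
  have : (k : ℝ) ≠ 0 := by positivity
  simp only [Function.comp_apply, slope_def_field, radialPoint, Real.exp_zero, sub_zero]
  field_simp
  ring

/-- Along the radial points, `(1 - x) ^ (log_k lam)` behaves like `lam ^ (-j)`. -/
theorem tendsto_one_sub_radialPoint_cpow {k : ℕ} (hk : 2 ≤ k) {lam : ℂ} (hlam : lam ≠ 0) :
    Tendsto (fun j => ((1 - radialPoint k j : ℝ) : ℂ) ^
      (Complex.log lam / (Real.log (k : ℝ) : ℂ)) * lam ^ j) atTop (𝓝 1) := by
  set s := Complex.log lam / (Real.log (k : ℝ) : ℂ) with hs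
  have hk0 : (0 : ℝ) < k := by positivity
  have hlogk : (Real.log (k : ℝ) : ℂ) ≠ 0 := by
    exact_mod_cast (Real.log_pos (by exact_mod_cast hk)).ne'
  have hks : ∀ j : ℕ, ((((k : ℝ) ^ j)⁻¹ : ℝ) : ℂ) ^ s * lam ^ j = 1 := by
    intro j
    rw [Complex.cpow_def_of_ne_zero (by exact_mod_cast (inv_pos.2 (pow_pos hk0 j)).ne'),
      ← Complex.ofReal_log (by positivity), Real.log_inv, Real.log_pow]
    rw [show lam ^ j = Complex.exp (j * Complex.log lam) by
      rw [Complex.exp_nat_mul, Complex.exp_log hlam], ← Complex.exp_add, hs, Complex.exp_eq_one_iff]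
    refine ⟨0, ?_⟩
    rw [Complex.ofReal_neg, Complex.ofReal_mul, Complex.ofReal_natCast]
    field_simp
    ring
  have h1 : Tendsto (fun j => (((1 - radialPoint k j) * (k : ℝ) ^ j : ℝ) : ℂ) ^ s)
      atTop (𝓝 1) := by
    have h2 := (Complex.continuous_ofReal.tendsto 1).comp (tendsto_one_sub_radialPoint_mul hk)
    have h3 : ContinuousAt (fun z : ℂ => z ^ s) ((1 : ℝ) : ℂ) :=
      continuousAt_id.cpow continuousAt_const (by simp)
    simpa [Function.comp_def] using h3.tendsto.comp h2
  refine h1.congr fun j => ?_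
  have hpos : 0 ≤ (1 - radialPoint k j) * (k : ℝ) ^ j :=
    mul_nonneg (sub_nonneg.2 (radialPoint_mem_Ioo hk j).2.le) (by positivity)
  have hsplit : (1 - radialPoint k j) =
      ((1 - radialPoint k j) * (k : ℝ) ^ j) * ((k : ℝ) ^ j)⁻¹ := by
    field_simp
  conv_rhs => rw [hsplit, Complex.ofReal_mul,
    Complex.mul_cpow_ofReal_nonneg hpos (by positivity), mul_assoc, hks, mul_one]

/-- Since `C` is constant along the radial points, the asymptotics of `F` there are purely
geometric, with ratio the Mahler eigenvalue. -/
theorem IsMahlerEigenvalue.tendsto_evalSeries {k : ℕ} (hk : 2 ≤ k) {F : PowerSeries ℂ} {lam : ℂ}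
    (h : IsMahlerEigenvalue k F lam) :
    ∃ c : ℂ, c ≠ 0 ∧
      Tendsto (fun j => evalSeries F (radialPoint k j : ℂ) / lam ^ j) atTop (𝓝 c) := by
  obtain ⟨hlam, -, C, -, ⟨b, B, hb, hbB⟩, hC, hequiv⟩ := h
  have hCj : ∀ j, C (radialPoint k j) = C (radialPoint k 0) := by
    intro j
    induction j with
    | zero => rfl
    | succ j ih => rw [hC _ (radialPoint_mem_Ioo hk _), radialPoint_succ_pow hk, ih]
  have hc : C (radialPoint k 0) ≠ 0 :=
    norm_pos_iff.1 (hb.trans_le (hbB _ (radialPoint_mem_Ioo hk 0)).1)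
  refine ⟨C (radialPoint k 0), hc, ?_⟩
  have h1 := hequiv.comp_tendsto (tendsto_radialPoint hk)
  have hne : ∀ j, ((1 - radialPoint k j : ℝ) : ℂ) ≠ 0 := fun j => by
    exact_mod_cast (sub_pos.2 (radialPoint_mem_Ioo hk j).2).ne'
  have hpow : ∀ j, ((1 - radialPoint k j : ℝ) : ℂ) ^
      (Complex.log lam / (Real.log (k : ℝ) : ℂ)) ≠ 0 := fun j =>
    fun h0 => hne j ((Complex.cpow_eq_zero_iff _ _).1 h0).1
  rw [Asymptotics.isEquivalent_iff_tendsto_one] at h1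
  · have h2 := (h1.mul_const (C (radialPoint k 0))).mul
      ((tendsto_one_sub_radialPoint_cpow hk hlam).inv₀ one_ne_zero)
    rw [one_mul, inv_one, mul_one] at h2
    refine h2.congr fun j => ?_
    simp only [Pi.div_apply, Function.comp_apply, hCj]
    have := hpow j
    field_simp
  · exact Eventually.of_forall fun j => by
      simpa [Function.comp_apply, hCj] using! div_ne_zero hc (hpow j)

theorem tendsto_ofReal_radialPoint {k : ℕ} (hk : 2 ≤ k) :
    Tendsto (fun j => (radialPoint k j : ℂ)) atTop (𝓝[≠] 1) := by
  refine tendsto_nhdsWithin_iff.2 ⟨?_, Eventually.of_forall fun j => ?_⟩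
  · simpa using! (Complex.continuous_ofReal.tendsto 1).comp
      ((tendsto_radialPoint hk).mono_right nhdsWithin_le_nhds)
  · simpa using (radialPoint_mem_Ioo hk j).2.ne

/-- A meromorphic function of finite order `m` at `1` grows along the radial points like a geometric
sequence of ratio `k ^ (-m)`. -/
theorem tendsto_meromorphic_radialPoint {k : ℕ} (hk : 2 ≤ k) {g : ℂ → ℂ}
    (hg : MeromorphicAt g 1) (hord : meromorphicOrderAt g 1 ≠ ⊤) :
    ∃ (n : ℤ) (c : ℂ), c ≠ 0 ∧
      Tendsto (fun j => g (radialPoint k j : ℂ) / ((k : ℂ) ^ n) ^ j) atTop (𝓝 c) := by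
  obtain ⟨h, hh, hh1, hgh⟩ := (meromorphicOrderAt_ne_top_iff hg).1 hord
  set n := (meromorphicOrderAt g 1).untop₀ with hn
  have hk0 : (k : ℂ) ≠ 0 := by exact_mod_cast (by lia : k ≠ 0)
  have hto := tendsto_ofReal_radialPoint hk
  have hbase : Tendsto (fun j => ((radialPoint k j : ℂ) - 1) * (k : ℂ) ^ j) atTop (𝓝 (-1)) := by
    have h2 := ((Complex.continuous_ofReal.tendsto 1).comp
      (tendsto_one_sub_radialPoint_mul hk)).neg
    rw [Complex.ofReal_one] at h2
    refine h2.congr fun j => ?_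
    simp
    ring
  refine ⟨-n, (-1) ^ n * h 1, mul_ne_zero (zpow_ne_zero _ (by simp)) hh1, ?_⟩
  have hlim := (hbase.zpow₀ n (.inl (by simp))).mul
    (hh.continuousAt.tendsto.comp (hto.mono_right nhdsWithin_le_nhds))
  refine hlim.congr' ?_
  filter_upwards [hto.eventually hgh] with j hj
  rw [hj, mul_zpow, zpow_neg, inv_pow, div_inv_eq_mul, ← zpow_natCast, ← zpow_natCast,
    ← zpow_mul, ← zpow_mul, mul_comm n]
  simp only [Function.comp_apply, smul_eq_mul]
  ring

end

/-! ### Algebraic independence -/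

/-- The identity principle: a function meromorphic in the unit disc and zero near the origin
vanishes at those radial points at which it is continuous. -/
theorem eventually_radialPoint_eq_zero {k : ℕ} (hk : 2 ≤ k) {H : ℂ → ℂ}
    (hH : MeromorphicOn H (Metric.ball 0 1)) (h0 : ∀ᶠ z in 𝓝[≠] (0 : ℂ), H z = 0)
    (hcont : ∀ᶠ j in atTop, ContinuousAt H (radialPoint k j : ℂ)) :
    ∀ᶠ j in atTop, H (radialPoint k j : ℂ) = 0 := by
  filter_upwards [hcont] with j hj
  have hmem : (radialPoint k j : ℂ) ∈ Metric.ball (0 : ℂ) 1 := by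
    have := radialPoint_mem_Ioo hk j
    simpa [abs_of_pos this.1] using this.2
  have hev : ∀ᶠ z in 𝓝[≠] (radialPoint k j : ℂ), H z = 0 := by
    rw [← meromorphicOrderAt_eq_top_iff]
    by_contra hne
    exact hH.meromorphicOrderAt_ne_top_of_isPreconnected
      (convex_ball (0 : ℂ) 1).isPreconnected hmem (Metric.mem_ball_self one_pos) hne
      (meromorphicOrderAt_eq_top_iff.2 h0)
  exact tendsto_nhds_unique (l := 𝓝[≠] (radialPoint k j : ℂ))
    (hj.tendsto.mono_left nhdsWithin_le_nhds)
    (tendsto_const_nhds.congr' (hev.mono fun _ h => h.symm))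

/-- The geometric ratio `x ^ n * lam ^ μ` attached to a monomial determines the monomial, even if
the power `n` of `x` is allowed to depend on it. -/
theorem MultiplicativelyIndependent.exponent_eq {d : ℕ} {x : ℂ} {lam : Fin d → ℂ}
    (h : MultiplicativelyIndependent (Fin.cons x lam : Fin (d + 1) → ℂ)) {m n : ℤ}
    {μ ν : Fin d →₀ ℕ}
    (heq : x ^ m * ∏ i, lam i ^ μ i = x ^ n * ∏ i, lam i ^ ν i) : μ = ν := by
  have hx : x ≠ 0 := by simpa using h.1 0
  have hl : ∀ i, lam i ≠ 0 := fun i => by simpa using h.1 i.succ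
  have hz := h.2 (Fin.cons (m - n) fun i => (μ i : ℤ) - ν i) (by
    simp only [Fin.prod_univ_succ, Fin.cons_zero, Fin.cons_succ]
    simp only [zpow_sub₀ hx, zpow_sub₀ (hl _), zpow_natCast, Finset.prod_div_distrib]
    have h1 := zpow_ne_zero n hx
    have h2 : ∏ i, lam i ^ ν i ≠ 0 := Finset.prod_ne_zero_iff.2 fun i _ => pow_ne_zero _ (hl i)
    rw [div_mul_div_comm, heq, div_self (mul_ne_zero h1 h2)])
  ext i
  have := congrFun hz i.succ
  simp only [Fin.cons_succ, Pi.zero_apply] at this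
  lia

theorem ConvergesInUnitDisc.isLaurentExpansion {F : PowerSeries ℂ} (h : ConvergesInUnitDisc F) :
    IsLaurentExpansion (F : ℂ⸨X⸩) (evalSeries F) := by
  refine .coe_powerSeries ?_
  filter_upwards [mem_nhdsWithin_of_mem_nhds (Metric.ball_mem_nhds (0 : ℂ) one_pos)] with z hz
  exact (h z (by simpa using hz)).hasSum

theorem algebraicIndependent_meromorphicField {k : ℕ} (hk : 2 ≤ k) {d : ℕ}
    {F : Fin d → PowerSeries ℂ} (hconv : ∀ i, ConvergesInUnitDisc (F i)) {lam : Fin d → ℂ}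
    (hlam : ∀ i, IsMahlerEigenvalue k (F i) (lam i))
    (hind : MultiplicativelyIndependent (Fin.cons (k : ℂ) lam : Fin (d + 1) → ℂ)) :
    AlgebraicIndependent meromorphicField (fun i => ((F i : PowerSeries ℂ) : ℂ⸨X⸩)) := by
  rw [algebraicIndependent_iff]
  intro P hP
  have hk0 : (k : ℂ) ≠ 0 := by exact_mod_cast (by lia : k ≠ 0)
  choose g hgm hg using fun μ => exists_meromorphic_of_mem_meromorphicField (P.coeff μ).2
  -- the relation between the series becomes a relation between functions
  set t : (Fin d →₀ ℕ) → ℂ → ℂ := fun μ => g μ * ∏ i, evalSeries (F i) ^ μ i with ht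
  have hrel : ∀ᶠ z in 𝓝[≠] (0 : ℂ), (∑ μ ∈ P.support, t μ) z = 0 := by
    have h1 : IsLaurentExpansion (∑ μ ∈ P.support, ((P.coeff μ : meromorphicField) : ℂ⸨X⸩) *
        ∏ i, ((F i : PowerSeries ℂ) : ℂ⸨X⸩) ^ μ i) (∑ μ ∈ P.support, t μ) :=
      .finset_sum _ fun μ _ => (hg μ).mul
        (.finset_prod _ fun i _ => ((hconv i).isLaurentExpansion).pow _)
    have h2 : (∑ μ ∈ P.support, ((P.coeff μ : meromorphicField) : ℂ⸨X⸩) *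
        ∏ i, ((F i : PowerSeries ℂ) : ℂ⸨X⸩) ^ μ i) = 0 := by
      rw [← hP, MvPolynomial.aeval_def, MvPolynomial.eval₂_eq']
      rfl
    rw [h2] at h1
    filter_upwards [h1] with z hz
    exact hz.unique (by simp)
  have hF : ∀ i, AnalyticOnNhd ℂ (evalSeries (F i)) (Metric.ball 0 1) :=
    fun i => analyticOnNhd_evalSeries (hconv i)
  have hmero : MeromorphicOn (∑ μ ∈ P.support, t μ) (Metric.ball 0 1) := fun z hz =>
    .sum fun μ _ => (hgm μ z).mul (.prod fun i _ => ((hF i z hz).meromorphicAt).pow _)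
  have hpt : ∀ j, (radialPoint k j : ℂ) ∈ Metric.ball (0 : ℂ) 1 := fun j => by
    have := radialPoint_mem_Ioo hk j
    simpa [abs_of_pos this.1] using this.2
  have hcont : ∀ᶠ j in atTop, ContinuousAt (∑ μ ∈ P.support, t μ) (radialPoint k j : ℂ) := by
    -- the coefficients are meromorphic at `1`, so their poles do not accumulate there
    have h1 : ∀ᶠ z in 𝓝[≠] (1 : ℂ), ∀ μ ∈ P.support, AnalyticAt ℂ (g μ) z :=
      (Finset.eventually_all _).2 fun μ _ => (hgm μ 1).eventually_analyticAt
    filter_upwards [(tendsto_ofReal_radialPoint hk).eventually h1] with j hj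
    exact (Finset.analyticAt_sum _ fun μ hμ => (hj μ hμ).mul
      (Finset.analyticAt_prod _ fun i _ => (hF i _ (hpt j)).pow _)).continuousAt
  have hzero := eventually_radialPoint_eq_zero hk hmero hrel hcont
  -- a coefficient of infinite order at `1` vanishes near `0`, hence has zero Laurent series
  have hord : ∀ μ ∈ P.support, meromorphicOrderAt (g μ) 1 ≠ ⊤ := by
    intro μ hμ
    refine (hgm μ).meromorphicOn.meromorphicOrderAt_ne_top_of_isPreconnected isPreconnected_univ
      (Set.mem_univ 0) (Set.mem_univ 1) fun h0 => MvPolynomial.mem_support_iff.1 hμ ?_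
    exact Subtype.ext ((hg μ).congr (meromorphicOrderAt_eq_top_iff.1 h0)).eq_zero
  choose c hc hcF using fun i => (hlam i).tendsto_evalSeries hk
  have hg1 : ∀ μ, ∃ (n : ℤ) (c : ℂ), μ ∈ P.support → c ≠ 0 ∧
      Tendsto (fun j => g μ (radialPoint k j : ℂ) / ((k : ℂ) ^ n) ^ j) atTop (𝓝 c) := by
    intro μ
    by_cases hμ : μ ∈ P.support
    · obtain ⟨n, c, h⟩ := tendsto_meromorphic_radialPoint hk (hgm μ 1) (hord μ hμ)
      exact ⟨n, c, fun _ => h⟩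
    · exact ⟨0, 0, fun h => absurd h hμ⟩
  choose n e he using hg1
  refine MvPolynomial.support_eq_empty.1 (eq_empty_of_eventually_sum_eq_zero P.support
    (fun μ => (k : ℂ) ^ n μ * ∏ i, lam i ^ μ i) (fun μ _ => ?_)
    (fun μ _ ν _ h => hind.exponent_eq h) (fun μ j => t μ (radialPoint k j : ℂ))
    (fun μ => e μ * ∏ i, c i ^ μ i) (fun μ hμ => ?_) (fun μ hμ => ?_) ?_)
  · exact mul_ne_zero (zpow_ne_zero _ hk0)
      (Finset.prod_ne_zero_iff.2 fun i _ => pow_ne_zero _ (hlam i).1)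
  · exact mul_ne_zero (he μ hμ).1 (Finset.prod_ne_zero_iff.2 fun i _ => pow_ne_zero _ (hc i))
  · refine ((he μ hμ).2.mul (tendsto_finsetProd Finset.univ
      fun i _ => (hcF i).pow (μ i))).congr fun j => ?_
    simp only [ht, Pi.mul_apply, Finset.prod_apply, Pi.pow_apply, mul_pow, ← Finset.prod_pow,
      div_pow, Finset.prod_div_distrib, div_mul_div_comm]
    simp only [← pow_mul, mul_comm]
  · filter_upwards [hzero] with j hj
    simpa using hj

theorem AlgebraicIndependent.trdeg_adjoin_range {K L : Type*} [Field K] [Field L] [Algebra K L]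
    {d : ℕ} {x : Fin d → L} (hx : AlgebraicIndependent K x) :
    Algebra.trdeg K (IntermediateField.adjoin K (Set.range x)) = (d : Cardinal) := by
  have h1 := hx.aevalEquivField.lift_trdeg_eq
  have h2 := trdeg_add_eq K (MvPolynomial (Fin d) K)
    (A := FractionRing (MvPolynomial (Fin d) K))
  have h3 : Algebra.IsAlgebraic (MvPolynomial (Fin d) K) (FractionRing (MvPolynomial (Fin d) K)) :=
    IsLocalization.isAlgebraic _ (nonZeroDivisors (MvPolynomial (Fin d) K))
  rw [trdeg_eq_zero (R := MvPolynomial (Fin d) K), add_zero, MvPolynomial.trdeg_of_isDomain] at h2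
  rw [← h2] at h1
  simpa using h1.symm

theorem theorem1 (k : ℕ) (hk : 2 ≤ k) (d : ℕ) (F : Fin d → PowerSeries ℂ)
    (hMahler : ∀ i, IsMahler k (F i))
    (hconv : ∀ i, ConvergesInUnitDisc (F i))
    (lam : Fin d → ℂ)
    (hlam : ∀ i, IsMahlerEigenvalue k (F i) (lam i))
    (hind : MultiplicativelyIndependent (Fin.cons (k : ℂ) lam : Fin (d + 1) → ℂ)) :
    Algebra.trdeg meromorphicField
        (IntermediateField.adjoin meromorphicField
          (Set.range fun i => ((F i : PowerSeries ℂ) : ℂ⸨X⸩))) = (d : Cardinal) ∧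
    AlgebraicIndependent meromorphicField (fun i => ((F i : PowerSeries ℂ) : ℂ⸨X⸩)) ∧
    AlgebraicIndependent (RatFunc ℂ) (fun i => ((F i : PowerSeries ℂ) : ℂ⸨X⸩)) := by
  have h := algebraicIndependent_meromorphicField hk hconv hlam hind
  exact ⟨h.trdeg_adjoin_range, h,
    h.restrictScalars (algebraMap (RatFunc ℂ) meromorphicField).injective⟩
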